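/- Let $\mathfrak g$ be a finite-dimensional simple Lie algebra over $\mathbb C$ with Chevalley generators $e_i,f_i,h_i$ ($i\in I$), Cartan subalgebra $\mathfrak h=\langle h_i\rangle$ and highest root $\theta$. Let $\langle\,,\rangle$ be the normalized invariant form (the invariant form whose induced form on $\mathfrak h^*$ satisfies $\langle\theta,\theta\rangle=2$), and let $\check h$ be the dual Coxeter number of $\mathfrak g$, that is, $1$ plus the sum of the coefficients of the coroot $\theta^\vee$ in the simple coroots. Let $\sigma$ be a special automorphism of $\mathfrak g$, that is, one of the following: * a diagram automorphism, $\sigma(e_i)=e_{\tau(i)}$, $\sigma(f_i)=f_{\tau(i)}$ for a symmetry $\tau$ of the Dynkin diagram (possibly the identity); * if $\mathfrak g$ is of type $A_{2n}$ ($n\ge 1$) with standard labelling $1,\dots,2n$: the automorphism $\sigma$ with $\sigma(e_i)=c_ie_{2n+1-i}$, $\sigma(f_i)=c_i^{-1}f_{2n+1-i}$, where $c_n=c_{n+1}=\sqrt{-1}$ and $c_i=1$ for all other $i$ (it has order $4$), or its inverse. Let $m$ be the order of $\sigma$ and $\epsilon=e^{2\pi \mathrm i/m}$; for $n\in\mathbb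 Z$ let $\mathfrak g_{\underline n}$ be the $\epsilon^n$-eigenspace of $\sigma$. Write $x(n)=x\otimes t^n\in\mathfrak g\otimes\mathbb C[t,t^{-1}]$, let $\sigma$ act by $\sigma(x(n))=\epsilon^{-n}\sigma(x)(n)$, and put $L^-(\mathfrak g,\sigma)=(t^{-1}\mathfrak g[t^{-1}])^\sigma$. Let $\overline{ad}_u$ denote $ad_u$ followed by the projection of $\mathfrak g[t,t^{-1}]=t^{-1}\mathfrak g[t^{-1}]\oplus\mathfrak g[t]$ onto $t^{-1}\mathfrak g[t^{-1}]$. Let $\mathcal B$ be a basis of $\mathfrak g$ each of whose elements lies in some $\mathfrak g_{\underline n}$; for $b\in\mathcal B\cap\mathfrak g_{\underline n}$ write $[b]=\underline n\in\mathbb Z/m\mathbb Z$. Let $\{\check b\}_{b\in\mathcal B}$ be the dual basis with respect to $\langle\,,\rangle$, so that $\langle b,\check b'\rangle=\delta_{b,b'}$. Then for every $x(-p)\in L^-(\mathfrak g,\sigma)$ with $p\ge 1$, $$\sum_{k\ge 0,\; b\in\mathcal B,\; [b]=-\underline k} ad_{b(-k)}\,\overline{ad}_{\check b(k)}\, x(-p)=\frac{2p\check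 h}{m}\,x(-p),$$ where only finitely many terms of the sum are nonzero. In particular this holds when $\kappa$ is the compact conjugate-linear involution of $\mathfrak g$ ($e_i\mapsto -f_i$, $f_i\mapsto -e_i$, $h_i\mapsto -h_i$), $\mathcal B$ is moreover orthonormal for the Hermitian form $\{x,y\}=-\langle x,\kappa(y)\rangle$, and $\check b=-\kappa(b)$. -/

import Mathlib

open scoped TensorProduct

noncomputable section

namespace TwistedCasimir

open LieAlgebra

variable {g : Type*} [LieRing g] [LieAlgebra ℂ g]

/-! ### Gradings and loop algebras attached to an automorphism -/

/-- The order `m` of an automorphism `σ` of `g`. -/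
def autOrder (σ : g ≃ₗ⁅ℂ⁆ g) : ℕ := orderOf (σ.toLinearEquiv : Module.End ℂ g)

/-- The root of unity `ε = exp (2 π i / m)`, where `m` is the order of `σ`. -/
def eps (σ : g ≃ₗ⁅ℂ⁆ g) : ℂ := Complex.exp (2 * Real.pi * Complex.I / (autOrder σ : ℂ))

/-- The `εⁿ`-eigenspace of `σ`; it depends on `n` only modulo the order of `σ`. -/
def gradedPiece (σ : g ≃ₗ⁅ℂ⁆ g) (n : ℤ) : Submodule ℂ g :=
  Module.End.eigenspace (σ.toLinearEquiv : Module.End ℂ g) (eps σ ^ n)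

/-- The element `x(n) = x ⊗ tⁿ` of the loop algebra `g ⊗ ℂ[t, t⁻¹]`. -/
def loopElt (x : g) (n : ℤ) : loopAlgebra ℂ ℤ g :=
  (AddMonoidAlgebra.single n 1 : AddMonoidAlgebra ℂ ℤ) ⊗ₜ[ℂ] x

/-- The coefficient of `tⁿ` of an element of the loop algebra. -/
def loopCoeff (n : ℤ) : loopAlgebra ℂ ℤ g →ₗ[ℂ] g :=
  Finsupp.lapply n ∘ₗ (LoopAlgebra.toFinsupp ℂ ℤ g).toLinearMap

/-- The action of `σ` on the loop algebra, `σ (x(n)) = ε⁻ⁿ σ(x)(n)`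
(that is, `σ` also acts on `t` by `σ t = ε⁻¹ t`). -/
def loopAut (σ : g ≃ₗ⁅ℂ⁆ g) : loopAlgebra ℂ ℤ g →ₗ[ℂ] loopAlgebra ℂ ℤ g :=
  (LoopAlgebra.toFinsupp ℂ ℤ g).symm.toLinearMap ∘ₗ
    Finsupp.lsum ℂ (fun n : ℤ =>
      Finsupp.lsingle n ∘ₗ (eps σ ^ (-n) • (σ.toLinearEquiv : Module.End ℂ g))) ∘ₗ
    (LoopAlgebra.toFinsupp ℂ ℤ g).toLinearMap

/-- `L⁻(g, σ) = (t⁻¹ g[t⁻¹])^σ`. -/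
def Lminus (σ : g ≃ₗ⁅ℂ⁆ g) : Submodule ℂ (loopAlgebra ℂ ℤ g) :=
  LinearMap.eqLocus (loopAut σ) LinearMap.id ⊓ ⨅ n : ℕ, LinearMap.ker (loopCoeff (n : ℤ))

/-- The projection of `g ⊗ ℂ[t, t⁻¹] = t⁻¹ g[t⁻¹] ⊕ g[t]` onto its first summand; on
`σ`-invariants it is the projection onto `L⁻(g, σ)`. -/
def negProj : loopAlgebra ℂ ℤ g →ₗ[ℂ] loopAlgebra ℂ ℤ g :=
  (LoopAlgebra.toFinsupp ℂ ℤ g).symm.toLinearMap ∘ₗ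
    (Finsupp.supported g ℂ (Set.Iio (0 : ℤ))).subtype ∘ₗ
    Finsupp.restrictDom g ℂ (Set.Iio (0 : ℤ)) ∘ₗ
    (LoopAlgebra.toFinsupp ℂ ℤ g).toLinearMap

/-- The truncated adjoint action: `ad u` followed by the projection to negative degrees. -/
def adBar (u : loopAlgebra ℂ ℤ g) : loopAlgebra ℂ ℤ g →ₗ[ℂ] loopAlgebra ℂ ℤ g :=
  negProj ∘ₗ LieAlgebra.ad ℂ (loopAlgebra ℂ ℤ g) u

/-! ### The partial Casimir sum -/

section Casimir

variable {J : Type*}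

/-- The pairs `(k, b)` with `k ≥ 0` and `b` a basis vector of degree `-k`. -/
def casimirIndex (σ : g ≃ₗ⁅ℂ⁆ g) (B : J → g) : Set (ℕ × J) :=
  {q | B q.2 ∈ gradedPiece σ (-(q.1 : ℤ))}

/-- The operator `ad_{b(-k)} ∘ adBar_{b'(k)}`. -/
def casimirTerm (B B' : J → g) (q : ℕ × J) : loopAlgebra ℂ ℤ g →ₗ[ℂ] loopAlgebra ℂ ℤ g :=
  LieAlgebra.ad ℂ (loopAlgebra ℂ ℤ g) (loopElt (B q.2) (-(q.1 : ℤ))) ∘ₗ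
    adBar (loopElt (B' q.2) (q.1 : ℤ))

/-- The sum of all `ad_{b(-k)} adBar_{b'(k)} y` (`k ≥ 0`, `b` of degree `-k`) has only finitely
many nonzero terms, and its value is `z`. -/
def HasCasimirSum (σ : g ≃ₗ⁅ℂ⁆ g) (B B' : J → g) (y z : loopAlgebra ℂ ℤ g) : Prop :=
  {q ∈ casimirIndex σ B | casimirTerm B B' q y ≠ 0}.Finite ∧
    ∑ᶠ q ∈ casimirIndex σ B, casimirTerm B B' q y = z

end Casimir

/-! ### Special automorphisms -/

section Chevalley

variable {ι : Type*} [Fintype ι] {H : LieSubalgebra ℂ g}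

/-- `σ` is a diagram automorphism (possibly the identity) with respect to the Chevalley generators
`e i, f i, h i`. -/
def IsDiagramAut (c : LieAlgebra.Basis ι H) (σ : g ≃ₗ⁅ℂ⁆ g) : Prop :=
  ∃ τ : Equiv.Perm ι, (∀ i j, c.A (τ i) (τ j) = c.A i j) ∧
    ∀ i, σ (c.e i) = c.e (τ i) ∧ σ (c.f i) = c.f (τ i)

/-- The factor by which the order `4` automorphism of `A_{2n}` rescales the `i`-th generator
(nodes numbered `0, …, 2n-1`): `√-1` at the two middle nodes `n-1` and `n`, and `1` elsewhere. -/
def middleFactor {n : ℕ} (i : Fin (2 * n)) : ℂ :=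
  if i.val + 1 = n ∨ i.val = n then Complex.I else 1

/-- `g` is of type `A_{2n}` with nodes numbered along the diagram by `r`, and `σ = τ ∘ √-1^{ad h}`
where `τ` is the nontrivial diagram automorphism and `αᵢ(h)` is `1` at the two middle nodes and `0`
elsewhere. -/
def IsOrderFourAut (c : LieAlgebra.Basis ι H) (σ : g ≃ₗ⁅ℂ⁆ g) : Prop :=
  ∃ (n : ℕ) (r : Fin (2 * n) ≃ ι), 1 ≤ n ∧
    (∀ i j, c.A (r i) (r j) = CartanMatrix.A (2 * n) i j) ∧
    ∀ i, σ (c.e (r i)) = middleFactor i • c.e (r i.rev) ∧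
      σ (c.f (r i)) = (middleFactor i)⁻¹ • c.f (r i.rev)

/-- Special automorphisms: diagram automorphisms, and the order `4` automorphism of `A_{2n}`
and its inverse. -/
def IsSpecial (c : LieAlgebra.Basis ι H) (σ : g ≃ₗ⁅ℂ⁆ g) : Prop :=
  IsDiagramAut c σ ∨ IsOrderFourAut c σ ∨ IsOrderFourAut c σ.symm

/-- `κ` is the compact involution: the conjugate-linear automorphism of `g` with `e i ↦ -f i`,
`f i ↦ -e i`, `h i ↦ -h i`. -/
def IsCompactInvolution (c : LieAlgebra.Basis ι H) (κ : g →ₛₗ[starRingEnd ℂ] g) : Prop :=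
  (∀ x y, κ ⁅x, y⁆ = ⁅κ x, κ y⁆) ∧
    ∀ i, κ (c.e i) = -c.f i ∧ κ (c.f i) = -c.e i ∧ κ (c.h i) = -c.h i

/-! ### Highest root, normalized form, dual Coxeter number -/

section Form

variable [FiniteDimensional ℂ g] [LieAlgebra.IsSimple ℂ g] (c : LieAlgebra.Basis ι H)

theorem exists_highestRoot :
    letI := c.isCartanSubalgebra
    ∃ θ : H.root, ∀ β : H.root, c.base.height β ≤ c.base.height θ := by
  let _ := c.isCartanSubalgebra
  have hι : Nonempty ι := by
    by_contra hι
    rw [not_nonempty_iff] at hι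
    have h1 := c.span_ef
    rw [Set.range_eq_empty, Set.range_eq_empty, Set.union_self, LieSubalgebra.span_empty] at h1
    have h2 : ∀ x : g, x = 0 := fun x => by
      have hx : x ∈ (⊤ : LieSubalgebra ℂ g) := LieSubalgebra.mem_top x
      rw [← h1] at hx
      simpa using hx
    exact LieAlgebra.IsSimple.non_abelian ℂ (L := g) ⟨fun x y => h2 _⟩
  have : Nonempty H.root := hι.map c.baseSupp'
  exact Finite.exists_max (fun β : H.root => c.base.height β)

/-- The highest root `θ`, i.e. the (unique) root of maximal height. -/
def highestRoot :
    letI := c.isCartanSubalgebra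
    H.root :=
  (exists_highestRoot c).choose

/-- The square length `⟨θ, θ⟩` of the highest root with respect to the form on `H*` induced by the
Killing form. -/
def killingLengthSq : ℂ :=
  letI := c.isCartanSubalgebra
  letI t := (IsKilling.cartanEquivDual H).symm (highestRoot c).1.toLinear
  killingForm ℂ g t t

/-- The normalized invariant form: the multiple of the Killing form for which the induced form on
`H*` satisfies `⟨θ, θ⟩ = 2`. -/
def normalizedForm : LinearMap.BilinForm ℂ g := (killingLengthSq c / 2) • killingForm ℂ g

/-- The dual Coxeter number: `1` plus the sum of the coefficients of the coroot `θ^∨` in terms of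
the simple coroots. -/
def dualCoxeterNumber : ℤ :=
  letI := c.isCartanSubalgebra
  1 + c.base.flip.height (highestRoot c)

/-- The Hermitian form `{x, y} = -⟨x, κ y⟩`. -/
def hermForm (κ : g →ₛₗ[starRingEnd ℂ] g) (x y : g) : ℂ := -normalizedForm c x (κ y)

end Form

end Chevalley

end TwistedCasimir

end

/-!
Only the terms with `k < p` survive the truncation, so the Casimir sum sends `x(-p)` to `Z(-p)`,
where `Z = ∑_{k < p} C_k x` and `C_k = ∑ ad b ∘ ad b'`, summed over the basis vectors `b` in the
`ε⁻ᵏ`-eigenspace of `σ`. By invariance of the form, `⟨C_k x, y⟩` is the trace of `ad x ∘ ad y` on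
this eigenspace, that is, `T_k = tr (ad x ∘ ad y ∘ P_k)` with `P_k` the projection onto it
(`form_partialCasimir_eq_trace`).

Periodicity. As `x` lies in the `ε⁻ᵖ`-eigenspace, `P_{k+p} ∘ ad x = ad x ∘ P_k`. Moving `ad x`
around the trace therefore gives `T_{k+p} = T_k + (a trace of ad ⁅x, y⁆ on an eigenspace)`. The functional
`z ↦ tr (ad z ∘ P_k)` is `σ`-invariant and vanishes on brackets with fixed elements, so it is
represented for the Killing form by a central element of the fixed subalgebra `g^σ`; hence it
vanishes when that centre is trivial (`trace_ad_mul_gradedProj_eq_zero`). Then `k ↦ T_k` has both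
`p` and the order `m` of `σ` as periods, and its sum over `k < p` is `p / m` times its sum over
`k < m`, which is the Killing form `κ(x, y)` (`sum_trace_ad_mul_ad_mul_gradedProj`).

The centre of `g^σ`. This is where `σ` being special enters (`IsSpecial.eq_zero_of_central_fixed`).
The element `ρ^∨` is fixed by `σ` and regular, so a central element `u` lies in the Cartan
subalgebra. For a diagram automorphism `∑ e_i` is fixed, whence all simple roots vanish on `u`. For
the automorphism of order four the same argument handles the nodes off the middle, and the bracket
of the two middle generators is fixed as well, which handles the rest because the two middle
simple roots agree on `u`.

Normalization. The normalized form is `L / 2` times the Killing form, with `L` the square length of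
the highest root `θ` for the latter, and `L` is the inverse of the dual Coxeter number
(`killingLengthSq_mul_dualCoxeterNumber`). Indeed `4 / L = κ(θ^∨, θ^∨) = ∑_α ⟨α, θ^∨⟩²`; positive
roots other than `θ` pair to `0` or `1` with `θ^∨`, so the squares may be dropped, and the sum
of the positive roots pairs to `2` with each simple coroot.
-/

/-! ### Sums of pairings with the highest coroot -/

namespace RootPairing.Base

theorem isPos_of_forall_height_le {ι R M N : Type*} [CommRing R] [CharZero R]
    [AddCommGroup M] [Module R M] [AddCommGroup N] [Module R N]
    {P : RootPairing ι R M N} {b : P.Base} {θ : ι} (hθ : ∀ i, b.height i ≤ b.height θ) :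
    b.IsPos θ := by
  let := P.indexNeg
  rcases IsPos.or_neg b θ with h | h
  · exact h
  · exact lt_of_lt_of_le h (hθ _)

variable {ι R M N : Type*} [Finite ι] [CommRing R] [CharZero R] [IsDomain R]
  [AddCommGroup M] [Module R M] [AddCommGroup N] [Module R N]
  {P : RootPairing ι R M N} [P.IsCrystallographic] [P.IsReduced] (b : P.Base)

open Classical in
/-- The sum `2ρ` of the positive roots pairs to `2` with every simple coroot: the simple reflection
`s_j` permutes the positive roots other than `α_j` and changes the sign of the pairing. -/
theorem sum_isPos_pairingIn_of_mem_support [Fintype ι] {j : ι} (hj : j ∈ b.support) :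
    ∑ i with b.IsPos i, P.pairingIn ℤ i j = 2 := by
  have hjpos : b.IsPos j := isPos_of_mem_support hj
  have hmem : j ∈ Finset.univ.filter (fun i => b.IsPos i) := by simpa using hjpos
  rw [← Finset.add_sum_erase _ _ hmem, P.pairingIn_same ℤ]
  have hrefl : ∀ i, P.pairingIn ℤ (P.reflectionPerm j i) j = -P.pairingIn ℤ i j := fun i =>
    FaithfulSMul.algebraMap_injective ℤ R <| by
      rw [map_neg, algebraMap_pairingIn, algebraMap_pairingIn, ← pairing_reflectionPerm,
        pairing_reflectionPerm_self_right]
  have hmap : ∀ i ∈ (Finset.univ.filter (fun i => b.IsPos i)).erase j,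
      P.reflectionPerm j i ∈ (Finset.univ.filter (fun i => b.IsPos i)).erase j := by
    intro i hi
    simp only [Finset.mem_erase, Finset.mem_filter, Finset.mem_univ, true_and] at hi ⊢
    refine ⟨fun h => ?_, hi.2.reflectionPerm hj hi.1⟩
    let := P.indexNeg
    have hij : i = -j := by
      rw [← P.reflectionPerm_self j i, h]; rfl
    have := (IsPos.neg_iff_not b j).mp (hij ▸ hi.2)
    exact this hjpos
  have hsum : ∑ i ∈ (Finset.univ.filter (fun i => b.IsPos i)).erase j, P.pairingIn ℤ i j =
      ∑ i ∈ (Finset.univ.filter (fun i => b.IsPos i)).erase j, -P.pairingIn ℤ i j :=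
    Finset.sum_nbij' (P.reflectionPerm j) (P.reflectionPerm j) hmap hmap
      (fun i _ => by simp) (fun i _ => by simp) (fun i _ => by rw [hrefl, neg_neg])
  rw [Finset.sum_neg_distrib] at hsum
  lia

open Classical in
theorem sum_isPos_pairingIn [Fintype ι] (k : ι) :
    ∑ i with b.IsPos i, P.pairingIn ℤ i k = 2 * b.flip.height k := by
  obtain ⟨f, -, -, hf⟩ := b.flip.exists_root_eq_sum_int k
  rw [height_eq_sum hf]
  have hpair : ∀ i, P.pairingIn ℤ i k = ∑ j ∈ b.support, f j * P.pairingIn ℤ i j := fun i =>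
    FaithfulSMul.algebraMap_injective ℤ R <| by
      have : P.coroot k = ∑ j ∈ b.support, f j • P.coroot j := hf
      rw [map_sum, algebraMap_pairingIn, ← root_coroot_eq_pairing, this]
      simp_rw [map_sum, map_zsmul, root_coroot_eq_pairing, map_mul, algebraMap_pairingIn,
        zsmul_eq_mul, algebraMap_int_eq, eq_intCast]
  simp_rw [hpair]
  rw [Finset.sum_comm, Finset.mul_sum]
  refine Finset.sum_congr rfl fun j hj => ?_
  rw [← Finset.mul_sum, b.sum_isPos_pairingIn_of_mem_support hj, mul_comm]

section Highest

variable {b} {θ : ι} (hθ : ∀ i, b.height i ≤ b.height θ)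
include hθ

omit [P.IsReduced] in
/-- A positive root pairing negatively with `θ^∨` could be added to `θ`, giving a higher root. -/
theorem pairingIn_nonneg_of_forall_height_le {i : ι} (hi : b.IsPos i) :
    0 ≤ P.pairingIn ℤ i θ := by
  by_contra! hneg
  let := P.indexNeg
  have hpos := isPos_of_forall_height_le hθ
  obtain ⟨k, hk⟩ := P.root_add_root_mem_of_pairingIn_neg hneg (fun h => by
    have h1 : i = -θ := P.root.injective (by simpa using h)
    exact (IsPos.neg_iff_not b θ).mp (h1 ▸ hi) hpos)
  have h1 := hθ k
  rw [b.height_add hk] at h1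
  have : 0 < b.height i := hi
  lia

omit [P.IsReduced] in
theorem pairingIn_le_one_of_forall_height_le {i : ι} (hi : i ≠ θ) :
    P.pairingIn ℤ i θ ≤ 1 := by
  by_contra! htwo
  let := P.indexNeg
  obtain ⟨k, hk⟩ := P.root_sub_root_mem_of_pairingIn_pos (i := i) (j := θ) (by lia) hi
  -- The reflection of `i` in `θ` is `i - ⟨i, θ^∨⟩ θ`, whose negative is too high unless the
  -- heights of `i` and `θ` agree; but then `i - θ` is a root of height `0`.
  have h1 : P.root (P.reflectionPerm θ i) = P.root i + (-P.pairingIn ℤ i θ) • P.root θ := by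
    rw [root_reflectionPerm, neg_smul, reflection_apply_root' ℤ, sub_eq_add_neg]
  have h2 := hθ (-(P.reflectionPerm θ i))
  rw [b.height_reflectionPerm_self, b.height_add_zsmul h1] at h2
  have h3 := b.height_ne_zero k
  rw [b.height_sub hk] at h3
  have h4 := hθ i
  have h5 : 0 < b.height θ := isPos_of_forall_height_le hθ
  simp only [smul_eq_mul]
      at h2
  have h6 : b.height i < b.height θ := by lia
  nlinarith

/-- For a root `θ` of maximal height, every positive root other than `θ` pairs to `0` or `1` with
`θ^∨`, so that the sum of squares reduces to the sum of the pairings. -/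
theorem sum_pairingIn_sq_of_forall_height_le [Fintype ι] :
    ∑ i, P.pairingIn ℤ i θ ^ 2 = 4 * (1 + b.flip.height θ) := by
  classical
  let := P.indexNeg
  have hθpos := isPos_of_forall_height_le hθ
  have hmem : θ ∈ Finset.univ.filter (fun i => b.IsPos i) := by simpa using hθpos
  have hlin := b.sum_isPos_pairingIn θ
  rw [← Finset.add_sum_erase _ _ hmem, P.pairingIn_same ℤ] at hlin
  have hsq : ∑ i ∈ (Finset.univ.filter (fun i => b.IsPos i)).erase θ, P.pairingIn ℤ i θ ^ 2 =
      ∑ i ∈ (Finset.univ.filter (fun i => b.IsPos i)).erase θ, P.pairingIn ℤ i θ := by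
    refine Finset.sum_congr rfl fun i hi => ?_
    simp only [Finset.mem_erase, Finset.mem_filter, Finset.mem_univ, true_and] at hi
    have h0 := pairingIn_nonneg_of_forall_height_le hθ hi.2
    have h1 := pairingIn_le_one_of_forall_height_le hθ hi.1
    interval_cases P.pairingIn ℤ i θ <;> rfl
  have hpos : ∑ i with b.IsPos i, P.pairingIn ℤ i θ ^ 2 = 2 * (1 + b.flip.height θ) := by
    rw [← Finset.add_sum_erase _ _ hmem, P.pairingIn_same ℤ, hsq]
    lia
  have hneg : ∑ i with ¬ b.IsPos i, P.pairingIn ℤ i θ ^ 2 =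
      ∑ i with b.IsPos i, P.pairingIn ℤ i θ ^ 2 := by
    refine Finset.sum_nbij' (fun i => -i) (fun i => -i) ?_ ?_ (fun i _ => neg_neg i)
      (fun i _ => neg_neg i) (fun i _ => ?_)
    · intro i hi
      simp only [Finset.mem_filter, Finset.mem_univ, true_and] at hi ⊢
      exact (IsPos.neg_iff_not b i).mpr hi
    · intro i hi
      simp only [Finset.mem_filter, Finset.mem_univ, true_and] at hi ⊢
      exact fun h => (IsPos.neg_iff_not b i).mp h hi
    · have : P.pairingIn ℤ (-i) θ = -P.pairingIn ℤ i θ :=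
        FaithfulSMul.algebraMap_injective ℤ R (by simp)
      rw [this, neg_sq]
  rw [← Finset.sum_filter_add_sum_filter_not Finset.univ (fun i => b.IsPos i), hneg, hpos]
  ring

end Highest

end RootPairing.Base

/-! ### The Killing length of the highest root -/

namespace TwistedCasimir

open LieAlgebra

variable {g : Type*} [LieRing g] [LieAlgebra ℂ g] [FiniteDimensional ℂ g] [LieAlgebra.IsSimple ℂ g]
  {ι : Type*} [Fintype ι] {H : LieSubalgebra ℂ g}

/-- The square length of the highest root for the Killing form is the inverse of the dual Coxeter
number: both are read off from `κ(θ^∨, θ^∨) = ∑ α, ⟨α, θ^∨⟩²`. -/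
theorem killingLengthSq_mul_dualCoxeterNumber (c : LieAlgebra.Basis ι H) :
    killingLengthSq c * (dualCoxeterNumber c : ℂ) = 1 := by
  let := c.isCartanSubalgebra
  set θ := highestRoot c with hθdef
  have hθ : ∀ β : H.root, c.base.height β ≤ c.base.height θ := (exists_highestRoot c).choose_spec
  set t := (IsKilling.cartanEquivDual H).symm θ.1.toLinear with ht
  have hform : ∀ x y : H, killingForm ℂ g x y = ∑ α ∈ H.root, α x * α y := by
    intro x y
    have h := LinearMap.congr_fun₂
      (IsKilling.restrict_killingForm_eq_sum (K := ℂ) (L := g) (H := H)) x y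
    simp only [LinearMap.sum_apply, LinearMap.smulRight_apply, LinearMap.smul_apply, smul_eq_mul]
      at h
    exact h
  have hL : killingLengthSq c = θ.1 t := by
    have h : IsKilling.cartanEquivDual H t t = θ.1 t := by
      rw [ht, LinearEquiv.apply_symm_apply, LieModule.Weight.toLinear_apply]
    exact h
  have hL0 : θ.1 t ≠ 0 :=
    IsKilling.root_apply_cartanEquivDual_symm_ne_zero (LieSubalgebra.isNonZero_coe_root θ)
  have hco : IsKilling.coroot θ.1 = (2 * (θ.1 t)⁻¹) • t := by
    rw [IsKilling.coroot, mul_smul, two_smul, two_smul]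
  have hsum := RootPairing.Base.sum_pairingIn_sq_of_forall_height_le hθ
  have hsumC : ∑ α : H.root, (α.1 (IsKilling.coroot θ.1)) ^ 2 =
      4 * (dualCoxeterNumber c : ℂ) := by
    have h := congrArg (Int.cast : ℤ → ℂ) hsum
    push_cast at h
    rw [dualCoxeterNumber]
    push_cast
    rw [← h]
    refine Finset.sum_congr rfl fun α _ => ?_
    congr 1
    exact ((IsKilling.rootSystem H).algebraMap_pairingIn ℤ α θ).symm
  have hk : killingForm ℂ g (IsKilling.coroot θ.1) (IsKilling.coroot θ.1) =
      ∑ α : H.root, (α.1 (IsKilling.coroot θ.1)) ^ 2 := by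
    rw [hform, ← Finset.sum_coe_sort]
    exact Finset.sum_congr rfl fun α _ => (sq _).symm
  have htt : killingForm ℂ g t t = killingLengthSq c := rfl
  have hk2 : killingForm ℂ g (IsKilling.coroot θ.1) (IsKilling.coroot θ.1) =
      (2 * (θ.1 t)⁻¹) ^ 2 * killingLengthSq c := by
    rw [hco]
    rw [show ((((2 * (θ.1 t)⁻¹) • t : H)) : g) = (2 * (θ.1 t)⁻¹) • (t : g) from rfl]
    simp only [map_smul, LinearMap.smul_apply, smul_eq_mul, htt]
    ring
  rw [hk, hsumC, hL] at hk2
  rw [hL]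
  field_simp at hk2
  linear_combination hk2 / 4

end TwistedCasimir

/-! ### The centre of the fixed subalgebra -/

namespace TwistedCasimir

open LieAlgebra

section FixedCentre

variable {g : Type*} [LieRing g] [LieAlgebra ℂ g] {ι : Type*} [Fintype ι] {H : LieSubalgebra ℂ g}
  (c : LieAlgebra.Basis ι H)

theorem linearIndependent_e : LinearIndependent ℂ c.e := by
  rw [Fintype.linearIndependent_iff]
  intro x hx j
  have h1 : ⁅∑ i, x i • c.e i, c.f j⁆ = x j • c.h j := by
    rw [sum_lie, Finset.sum_eq_single j]
    · rw [smul_lie, (c.sl2 j).lie_e_f]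
    · intro i _ hij
      rw [smul_lie, c.lie_e_f_ne i j hij, smul_zero]
    · simp
  rw [hx, zero_lie] at h1
  exact (smul_eq_zero.mp h1.symm).resolve_right (c.linInd.ne_zero j)

theorem lie_e_e_ne_zero {i j : ι} (hij : i ≠ j) (hA : c.A j i ≠ 0) :
    ⁅c.e i, c.e j⁆ ≠ 0 := by
  intro h
  have h1 : ⁅c.f i, ⁅c.e i, c.e j⁆⁆ = -(c.A j i • c.e j) := by
    rw [leibniz_lie, ← lie_skew (c.f i) (c.e i), (c.sl2 i).lie_e_f, neg_lie, c.lie_h_e,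
      ← lie_skew (c.f i) (c.e j), c.lie_e_f_ne j i hij.symm, neg_zero, lie_zero, add_zero]
  rw [h, lie_zero, eq_comm, neg_eq_zero, ← Int.cast_smul_eq_zsmul ℂ, smul_eq_zero] at h1
  exact h1.elim (by exact_mod_cast hA) (c.sl2 j).e_ne_zero

theorem lie_e (u : H) (i : ι) : ⁅(u : g), c.e i⁆ = c.baseSupp i u • c.e i :=
  (c.baseSupp_apply_smul_e i u).symm

theorem lie_f (u : H) (i : ι) : ⁅(u : g), c.f i⁆ = -(c.baseSupp i u • c.f i) := by
  rw [c.baseSupp_apply_smul_f i u, neg_neg]; rfl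

theorem baseSupp_eq_zero_of_lie_sum_e_eq_zero {u : H} {s : Finset ι}
    (h : ⁅∑ i ∈ s, c.e i, (u : g)⁆ = 0) {i : ι} (hi : i ∈ s) : c.baseSupp i u = 0 := by
  rw [← lie_skew, neg_eq_zero, lie_sum] at h
  simp_rw [lie_e] at h
  exact linearIndependent_iff'.mp (linearIndependent_e c) s _ h i hi

omit [Fintype ι] in
/-- A linear endomorphism permuting a family of vectors up to fourth roots of unity has finite
order on this family. -/
theorem pow_orderOf_pow_four_apply {M : Type*} [AddCommGroup M] [Module ℂ M] {v : ι → M}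
    {T : Module.End ℂ M} {τ : Equiv.Perm ι} {a : ι → ℂ} (ha : ∀ i, a i ^ 4 = 1)
    (hT : ∀ i, T (v i) = a i • v (τ i)) (i : ι) : (T ^ (orderOf τ * 4)) (v i) = v i := by
  have hpow : ∀ n : ℕ, (T ^ n) (v i) = (∏ k ∈ Finset.range n, a ((τ ^ k) i)) • v ((τ ^ n) i) := by
    intro n
    induction n with
    | zero => simp
    | succ n ih =>
      rw [pow_succ', Module.End.mul_apply, ih, map_smul, hT, smul_smul, Finset.prod_range_succ,
        pow_succ', Equiv.Perm.mul_apply]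
  have hper : ∀ k, τ ^ (orderOf τ + k) = τ ^ k := fun k => by
    rw [pow_add, pow_orderOf_eq_one, one_mul]
  have hd := hpow (orderOf τ)
  rw [pow_orderOf_eq_one, Equiv.Perm.one_apply] at hd
  set A := ∏ k ∈ Finset.range (orderOf τ), a ((τ ^ k) i) with hA
  have hA4 : A ^ 4 = 1 := by rw [hA, ← Finset.prod_pow]; exact Finset.prod_eq_one fun k _ => ha _
  have hAn : ∀ n : ℕ, ((T ^ orderOf τ) ^ n) (v i) = A ^ n • v i := by
    intro n
    induction n with
    | zero => simp
    | succ n ih => rw [pow_succ, Module.End.mul_apply, hd, map_smul, ih, smul_smul, pow_succ']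
  rw [pow_mul, hAn, hA4, one_smul]

/-- `σ` permutes the Chevalley generators up to fourth roots of unity, with inverse scalars on
`e i` and `f i`, so that `σ` simply permutes the `h i`. -/
def IsMonomialAut (c : LieAlgebra.Basis ι H) (σ : g ≃ₗ⁅ℂ⁆ g) : Prop :=
  ∃ (τ : Equiv.Perm ι) (a : ι → ℂ), (∀ i, a i ^ 4 = 1) ∧ (∀ i, σ (c.e i) = a i • c.e (τ i)) ∧
    ∀ i, σ (c.f i) = (a i)⁻¹ • c.f (τ i)

theorem IsDiagramAut.isMonomialAut {c : LieAlgebra.Basis ι H} {σ : g ≃ₗ⁅ℂ⁆ g}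
    (hσ : IsDiagramAut c σ) : IsMonomialAut c σ := by
  obtain ⟨τ, -, hτ⟩ := hσ
  exact ⟨τ, fun _ => 1, fun _ => one_pow 4, fun i => by rw [one_smul, (hτ i).1],
    fun i => by rw [inv_one, one_smul, (hτ i).2]⟩

theorem IsOrderFourAut.isMonomialAut {c : LieAlgebra.Basis ι H} {σ : g ≃ₗ⁅ℂ⁆ g}
    (hσ : IsOrderFourAut c σ) : IsMonomialAut c σ := by
  obtain ⟨n, r, -, -, hr⟩ := hσ
  refine ⟨(r.symm.trans Fin.revPerm).trans r, fun i => middleFactor (r.symm i), fun i => ?_,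
    fun i => ?_, fun i => ?_⟩
  · dsimp only [middleFactor]
    split_ifs
    · exact Complex.I_pow_four
    · exact one_pow 4
  · simpa using (hr (r.symm i)).1
  · simpa using (hr (r.symm i)).2

theorem IsMonomialAut.isOfFinOrder {c : LieAlgebra.Basis ι H} {σ : g ≃ₗ⁅ℂ⁆ g}
    (hσ : IsMonomialAut c σ) : IsOfFinOrder (σ.toLinearEquiv : Module.End ℂ g) := by
  obtain ⟨τ, a, ha, he, hf⟩ := hσ
  set T : Module.End ℂ g := (σ.toLinearEquiv : Module.End ℂ g) with hT
  have hlie : ∀ (n : ℕ) (x y : g), (T ^ n) ⁅x, y⁆ = ⁅(T ^ n) x, (T ^ n) y⁆ := by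
    intro n
    induction n with
    | zero => simp
    | succ n ih =>
      intro x y
      rw [pow_succ', Module.End.mul_apply, ih]
      exact LieEquiv.map_lie σ _ _
  refine isOfFinOrder_iff_pow_eq_one.mpr
    ⟨orderOf τ * 4, Nat.mul_pos (orderOf_pos τ) (by decide), LinearMap.ext fun x => ?_⟩
  rw [Module.End.one_apply]
  have hx : x ∈ LieSubalgebra.lieSpan ℂ g (Set.range c.e ∪ Set.range c.f) := by
    rw [c.span_ef]; exact LieSubalgebra.mem_top x
  induction hx using LieSubalgebra.lieSpan_induction with
  | mem y hy =>
    rcases hy with ⟨i, rfl⟩ | ⟨i, rfl⟩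
    · exact pow_orderOf_pow_four_apply ha he i
    · exact pow_orderOf_pow_four_apply (fun i => by rw [inv_pow, ha, inv_one]) hf i
  | zero => rw [map_zero]
  | add y z _ _ hy hz => rw [map_add, hy, hz]
  | smul t y _ hy => rw [map_smul, hy]
  | lie y z _ _ hy hz => rw [hlie, hy, hz]

theorem IsSpecial.autOrder_pos {c : LieAlgebra.Basis ι H} {σ : g ≃ₗ⁅ℂ⁆ g} (hσ : IsSpecial c σ) :
    0 < autOrder σ := by
  rw [autOrder, orderOf_pos_iff]
  rcases hσ with h | h | h
  · exact h.isMonomialAut.isOfFinOrder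
  · exact h.isMonomialAut.isOfFinOrder
  · obtain ⟨n, hn, h1⟩ := isOfFinOrder_iff_pow_eq_one.mp h.isMonomialAut.isOfFinOrder
    refine isOfFinOrder_iff_pow_eq_one.mpr ⟨n, hn, ?_⟩
    have hcomm : Commute (σ.toLinearEquiv : Module.End ℂ g)
        (σ.symm.toLinearEquiv : Module.End ℂ g) :=
      LinearMap.ext fun x => (σ.apply_symm_apply x).trans (σ.symm_apply_apply x).symm
    have hinv : (σ.toLinearEquiv : Module.End ℂ g) * (σ.symm.toLinearEquiv : Module.End ℂ g) = 1 :=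
      LinearMap.ext fun x => σ.apply_symm_apply x
    rw [← mul_one ((σ.toLinearEquiv : Module.End ℂ g) ^ n), ← h1, ← hcomm.mul_pow, hinv, one_pow,
      h1]

variable [LieAlgebra.IsSimple ℂ g]

theorem eq_zero_of_lie_generators_eq_zero {u : g} (he : ∀ i, ⁅u, c.e i⁆ = 0)
    (hf : ∀ i, ⁅u, c.f i⁆ = 0) : u = 0 := by
  have hall : ∀ x : g, ⁅u, x⁆ = 0 := by
    intro x
    have hx : x ∈ LieSubalgebra.lieSpan ℂ g (Set.range c.e ∪ Set.range c.f) := by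
      rw [c.span_ef]; exact LieSubalgebra.mem_top x
    induction hx using LieSubalgebra.lieSpan_induction with
    | mem y hy =>
      rcases hy with ⟨i, rfl⟩ | ⟨i, rfl⟩
      · exact he i
      · exact hf i
    | zero => simp
    | add y z _ _ hy hz => rw [lie_add, hy, hz, add_zero]
    | smul t y _ hy => rw [lie_smul, hy, smul_zero]
    | lie y z _ _ hy hz => rw [leibniz_lie, hy, hz, zero_lie, lie_zero, add_zero]
  have hc : u ∈ LieAlgebra.center ℂ g := by
    rw [LieModule.mem_maxTrivSubmodule]
    intro x
    rw [← lie_skew, hall, neg_zero]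
  rwa [LieAlgebra.center_eq_bot, LieSubmodule.mem_bot] at hc

theorem eq_zero_of_baseSupp_eq_zero {u : H} (h : ∀ i, c.baseSupp i u = 0) : (u : g) = 0 :=
  eq_zero_of_lie_generators_eq_zero c (fun i => by rw [lie_e, h, zero_smul])
    (fun i => by rw [lie_f, h, zero_smul, neg_zero])

variable [FiniteDimensional ℂ g]

/-- The element `ρ^∨` of the Cartan subalgebra, on which every simple root takes the value `1`, is
regular: a root takes its height as value there, so the centralizer of `ρ^∨` is the Cartan
subalgebra. -/
theorem exists_regular_element :
    ∃ r : H, (∀ i, c.baseSupp i r = 1) ∧ ∀ u : g, ⁅(r : g), u⁆ = 0 → u ∈ H := by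
  let := c.isCartanSubalgebra
  let φ : Module.Dual ℂ (Module.Dual ℂ H) := c.base.toWeightBasis.constr ℂ (fun _ => (1 : ℂ))
  let r : H := (Module.evalEquiv ℂ H).symm φ
  have hr : ∀ ψ : Module.Dual ℂ H, ψ r = φ ψ := fun ψ => Module.apply_evalEquiv_symm_apply ℂ H ψ φ
  have hsimple : ∀ j ∈ c.base.support, (IsKilling.rootSystem H).root j r = 1 := by
    intro j hj
    rw [hr, ← c.base.toWeightBasis_apply ⟨j, hj⟩, Module.Basis.constr_basis]
  have hroot : ∀ α : H.root, α.1 r = (c.base.height α : ℂ) := by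
    intro α
    obtain ⟨f, -, -, hf⟩ := c.base.exists_root_eq_sum_int α
    rw [RootPairing.Base.height_eq_sum hf]
    have h1 : α.1 r = (IsKilling.rootSystem H).root α r := rfl
    rw [h1, hf, LinearMap.sum_apply, Int.cast_sum]
    refine Finset.sum_congr rfl fun j hj => ?_
    rw [LinearMap.smul_apply, hsimple j hj, zsmul_eq_mul, mul_one]
  refine ⟨r, fun i => hsimple _ (c.baseSupportEquiv i).2, ?_⟩
  -- `H` lies in the kernel of `ad r` and all root spaces lie in its range, so that a dimension
  -- count leaves no room for more in the kernel.
  set T := LieAlgebra.ad ℂ g (r : g) with hT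
  have hker : H.toSubmodule ≤ LinearMap.ker T := by
    intro x hx
    have := c.isLieAbelian_cartan
    have h : ⁅r, (⟨x, hx⟩ : H)⁆ = 0 := trivial_lie_zero _ _ _ _
    simpa [hT] using congrArg (Subtype.val) h
  have hrange : H.toSubmodule ⊔ LinearMap.range T = ⊤ := by
    rw [eq_top_iff]
    have htop := LieModule.iSup_genWeightSpace_eq_top' ℂ H g
    rw [← LieSubmodule.toSubmodule_inj, LieSubmodule.iSup_toSubmodule,
      LieSubmodule.top_toSubmodule] at htop
    rw [← htop, iSup_le_iff]
    intro χ x hx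
    by_cases hχ : χ.IsZero
    · refine Submodule.mem_sup_left ?_
      have h0 : x ∈ LieAlgebra.rootSpace H (0 : H → ℂ) := by
        rw [← hχ]; exact hx
      rw [← c.cartan_eq] at h0
      exact h0
    · refine Submodule.mem_sup_right ⟨(χ r)⁻¹ • x, ?_⟩
      have hmem : χ ∈ H.root := by simpa using hχ
      have hne : χ r ≠ 0 := by
        rw [hroot ⟨χ, hmem⟩]
        exact_mod_cast c.base.height_ne_zero _
      have h := IsKilling.lie_eq_smul_of_mem_rootSpace hx r
      change ⁅(r : g), (χ r)⁻¹ • x⁆ = x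
      rw [lie_smul]
      change (χ r)⁻¹ • ⁅r, x⁆ = x
      rw [h, smul_smul, inv_mul_cancel₀ hne, one_smul]
  have h1 := LinearMap.finrank_range_add_finrank_ker T
  have h2 := Submodule.finrank_add_le_finrank_add_finrank H.toSubmodule (LinearMap.range T)
  rw [hrange, finrank_top] at h2
  have heq := Submodule.eq_of_le_of_finrank_le hker (by lia)
  intro u hu
  have : u ∈ LinearMap.ker T := hu
  rwa [← heq] at this

/-- Automorphisms permuting the Chevalley generators up to scalars fix `ρ^∨`. Hence an element
fixed by `σ` and commuting with all fixed elements lies in the Cartan subalgebra. -/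
theorem mem_cartan_of_central_fixed {σ : g ≃ₗ⁅ℂ⁆ g} (hσ : IsMonomialAut c σ) {u : g}
    (hc : ∀ w, σ w = w → ⁅w, u⁆ = 0) : u ∈ H := by
  obtain ⟨τ, a, ha4, he, hf⟩ := hσ
  have ha : ∀ i, a i ≠ 0 := fun i h => by simpa [h] using ha4 i
  obtain ⟨r, hr1, hr2⟩ := exists_regular_element c
  have hre : ∀ i, ⁅σ (r : g), c.e (τ i)⁆ = c.e (τ i) := by
    intro i
    have h : σ ⁅(r : g), c.e i⁆ = σ (c.e i) := by rw [lie_e, hr1, one_smul]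
    rw [LieEquiv.map_lie, he, lie_smul] at h
    exact smul_right_injective g (ha i) h
  have hrf : ∀ i, ⁅σ (r : g), c.f (τ i)⁆ = -c.f (τ i) := by
    intro i
    have h : σ ⁅(r : g), c.f i⁆ = -σ (c.f i) := by rw [lie_f, hr1, one_smul, map_neg]
    rw [LieEquiv.map_lie, hf, lie_smul, ← smul_neg] at h
    exact smul_right_injective g (inv_ne_zero (ha i)) h
  have hfix : σ (r : g) - r = 0 := by
    refine eq_zero_of_lie_generators_eq_zero c (fun i => ?_) (fun i => ?_)
    · obtain ⟨j, rfl⟩ := τ.surjective i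
      rw [sub_lie, hre, lie_e, hr1, one_smul, sub_self]
    · obtain ⟨j, rfl⟩ := τ.surjective i
      rw [sub_lie, hrf, lie_f, hr1, one_smul, sub_self]
  exact hr2 u (hc _ (sub_eq_zero.mp hfix))

theorem IsDiagramAut.eq_zero_of_central_fixed {c : LieAlgebra.Basis ι H} {σ : g ≃ₗ⁅ℂ⁆ g}
    (hσ : IsDiagramAut c σ) {u : g} (hc : ∀ w, σ w = w → ⁅w, u⁆ = 0) : u = 0 := by
  have hu : u ∈ H := mem_cartan_of_central_fixed c hσ.isMonomialAut hc
  obtain ⟨τ, -, hτ⟩ := hσ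
  have hE : σ (∑ i, c.e i) = ∑ i, c.e i := by
    rw [map_sum]
    simp_rw [fun i => (hτ i).1]
    exact Equiv.sum_comp τ c.e
  exact eq_zero_of_baseSupp_eq_zero c (u := ⟨u, hu⟩) fun i =>
    baseSupp_eq_zero_of_lie_sum_e_eq_zero c (u := ⟨u, hu⟩) (hc _ hE) (Finset.mem_univ i)

/-- The generators attached to the nodes other than the two middle ones have a fixed sum, and so
has the bracket of the two middle generators, as `√-1 * √-1 * (-1) = 1`. The simple roots of the
middle nodes agree on a fixed element of the Cartan subalgebra. -/
theorem IsOrderFourAut.eq_zero_of_central_fixed {c : LieAlgebra.Basis ι H} {σ : g ≃ₗ⁅ℂ⁆ g}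
    (hσ : IsOrderFourAut c σ) {u : g} (hfix : σ u = u) (hc : ∀ w, σ w = w → ⁅w, u⁆ = 0) :
    u = 0 := by
  classical
  have hu : u ∈ H := mem_cartan_of_central_fixed c hσ.isMonomialAut hc
  obtain ⟨n, r, hn, hA, hr⟩ := hσ
  lift u to H using hu
  -- the nodes other than the middle ones
  let s : Finset (Fin (2 * n)) := Finset.univ.filter (fun i => ¬(i.val + 1 = n ∨ i.val = n))
  have hsrev : ∀ i ∈ s, i.rev ∈ s := by
    intro i hi
    simp only [s, Finset.mem_filter, Finset.mem_univ, true_and, Fin.val_rev] at hi ⊢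
    have := i.isLt
    lia
  have hE : σ (∑ i ∈ s.map r.toEmbedding, c.e i) = ∑ i ∈ s.map r.toEmbedding, c.e i := by
    rw [Finset.sum_map, map_sum]
    refine Finset.sum_nbij' Fin.rev Fin.rev hsrev hsrev (fun i _ => Fin.rev_rev i)
      (fun i _ => Fin.rev_rev i) fun i hi => ?_
    have : middleFactor i = 1 := if_neg (by simpa [s] using hi)
    change σ (c.e (r i)) = c.e (r i.rev)
    rw [(hr i).1, this, one_smul]
  have hside : ∀ i ∈ s, c.baseSupp (r i) u = 0 := fun i hi =>
    baseSupp_eq_zero_of_lie_sum_e_eq_zero c (hc _ hE) (Finset.mem_map_of_mem _ hi)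
  -- the two middle nodes
  let i₀ : Fin (2 * n) := ⟨n - 1, by lia⟩
  let i₁ : Fin (2 * n) := ⟨n, by lia⟩
  have hrev₀ : i₀.rev = i₁ := Fin.ext (by simp only [i₀, i₁, Fin.val_rev]; lia)
  have hrev₁ : i₁.rev = i₀ := by rw [← hrev₀, Fin.rev_rev]
  have hm₀ : middleFactor i₀ = Complex.I := if_pos (Or.inl (by simp only [i₀]; lia))
  have hm₁ : middleFactor i₁ = Complex.I := if_pos (Or.inr rfl)
  have hσ₀ : σ (c.e (r i₀)) = Complex.I • c.e (r i₁) := by rw [(hr i₀).1, hm₀, hrev₀]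
  have hσ₁ : σ (c.e (r i₁)) = Complex.I • c.e (r i₀) := by rw [(hr i₁).1, hm₁, hrev₁]
  have hne : i₀ ≠ i₁ := fun h => by
    have := congrArg Fin.val h
    simp only [i₀, i₁] at this
    lia
  have hw : σ ⁅c.e (r i₀), c.e (r i₁)⁆ = ⁅c.e (r i₀), c.e (r i₁)⁆ := by
    rw [LieEquiv.map_lie, hσ₀, hσ₁, smul_lie, lie_smul, smul_smul, Complex.I_mul_I, neg_one_smul,
      lie_skew]
  have hwne : ⁅c.e (r i₀), c.e (r i₁)⁆ ≠ 0 := by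
    refine lie_e_e_ne_zero c (fun h => hne (r.injective h)) ?_
    rw [hA]
    have : CartanMatrix.A (2 * n) i₁ i₀ = -1 := by
      simp only [CartanMatrix.A, Matrix.of_apply, i₀, i₁]
      rw [if_neg (by simp only [Fin.mk.injEq]; lia), if_pos (by lia)]
    rw [this]
    decide
  have hsum : c.baseSupp (r i₀) u + c.baseSupp (r i₁) u = 0 := by
    have h := hc _ hw
    rw [← lie_skew, neg_eq_zero, leibniz_lie, lie_e, lie_e, smul_lie, lie_smul, ← add_smul] at h
    exact (smul_eq_zero.mp h).resolve_right hwne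
  have hequal : c.baseSupp (r i₁) u = c.baseSupp (r i₀) u := by
    have h : σ ⁅(u : g), c.e (r i₀)⁆ = c.baseSupp (r i₀) u • σ (c.e (r i₀)) := by
      rw [lie_e, map_smul]
    rw [LieEquiv.map_lie, hfix, hσ₀, lie_smul, lie_e, smul_comm] at h
    have h2 := smul_left_injective ℂ (smul_ne_zero Complex.I_ne_zero (c.sl2 (r i₁)).e_ne_zero)
      (a₁ := c.baseSupp (r i₁) u) (a₂ := c.baseSupp (r i₀) u) h
    exact h2
  have h₀ : c.baseSupp (r i₀) u = 0 := by linear_combination (hsum - hequal) / 2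
  refine eq_zero_of_baseSupp_eq_zero c fun i => ?_
  obtain ⟨j, rfl⟩ := r.surjective i
  by_cases hj : j ∈ s
  · exact hside j hj
  · simp only [s, Finset.mem_filter, Finset.mem_univ, true_and, not_not] at hj
    rcases hj with hj | hj
    · rw [show j = i₀ from Fin.ext (by simp only [i₀]; lia)]
      exact h₀
    · rw [show j = i₁ from Fin.ext hj, hequal]
      exact h₀

/-- The fixed subalgebra of a special automorphism has trivial centre. -/
theorem IsSpecial.eq_zero_of_central_fixed {c : LieAlgebra.Basis ι H} {σ : g ≃ₗ⁅ℂ⁆ g}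
    (hσ : IsSpecial c σ) {u : g} (hfix : σ u = u) (hc : ∀ w, σ w = w → ⁅w, u⁆ = 0) : u = 0 := by
  rcases hσ with h | h | h
  · exact h.eq_zero_of_central_fixed hc
  · exact h.eq_zero_of_central_fixed hfix hc
  · refine h.eq_zero_of_central_fixed (σ.symm_apply_eq.mpr hfix.symm) fun w hw => hc w ?_
    exact (σ.symm_apply_eq.mp hw).symm

end FixedCentre

end TwistedCasimir

/-! ### Traces on the eigenspaces of an automorphism -/

namespace TwistedCasimir

open LieAlgebra

section GradedTrace

theorem sum_range_mul_of_periodic {M : Type*} [AddCommMonoid M] {f : ℕ → M} {p : ℕ}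
    (hf : ∀ k, f (k + p) = f k) (q : ℕ) :
    ∑ k ∈ Finset.range (q * p), f k = q • ∑ k ∈ Finset.range p, f k := by
  have hshift : ∀ q k, f (q * p + k) = f k := by
    intro q k
    induction q with
    | zero => rw [zero_mul, zero_add]
    | succ q ih => rw [add_one_mul, add_right_comm, hf, ih]
  induction q with
  | zero => simp
  | succ q ih => rw [add_one_mul, Finset.sum_range_add, ih, succ_nsmul]; simp_rw [hshift]

variable {g : Type*} [LieRing g] [LieAlgebra ℂ g]

theorem ad_lie_eq_mul_sub_mul (x y : g) : LieAlgebra.ad ℂ g ⁅x, y⁆ =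
    LieAlgebra.ad ℂ g x * LieAlgebra.ad ℂ g y - LieAlgebra.ad ℂ g y * LieAlgebra.ad ℂ g x :=
  LinearMap.ext fun z => lie_lie x y z

variable {σ : g ≃ₗ⁅ℂ⁆ g}

theorem mem_gradedPiece_iff {n : ℤ} {x : g} : x ∈ gradedPiece σ n ↔ σ x = eps σ ^ n • x :=
  Module.End.mem_eigenspace_iff

theorem eps_ne_zero : eps σ ≠ 0 := Complex.exp_ne_zero _

theorem isPrimitiveRoot_eps (hm : 0 < autOrder σ) : IsPrimitiveRoot (eps σ) (autOrder σ) :=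
  Complex.isPrimitiveRoot_exp _ hm.ne'

theorem toLinearEquiv_pow_apply_of_mem {n : ℤ} {x : g} (hx : x ∈ gradedPiece σ n) (l : ℕ) :
    ((σ.toLinearEquiv : Module.End ℂ g) ^ l) x = (eps σ ^ n) ^ l • x := by
  induction l with
  | zero => simp
  | succ l ih =>
    rw [pow_succ', Module.End.mul_apply, ih, map_smul]
    change _ • σ x = _
    rw [mem_gradedPiece_iff.mp hx, smul_smul, pow_succ]

variable (σ) in
/-- The projection of `g` onto the `ε⁻ᵏ`-eigenspace of `σ` along the other eigenspaces, as the
average of the operators `εᵏˡ σˡ`. -/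
noncomputable def gradedProj (k : ℤ) : Module.End ℂ g :=
  (autOrder σ : ℂ)⁻¹ • ∑ l ∈ Finset.range (autOrder σ),
    (eps σ ^ k) ^ l • (σ.toLinearEquiv : Module.End ℂ g) ^ l

theorem gradedProj_add_autOrder (hm : 0 < autOrder σ) (k : ℤ) :
    gradedProj σ (k + autOrder σ) = gradedProj σ k := by
  rw [gradedProj, gradedProj, zpow_add₀ eps_ne_zero, zpow_natCast,
    (isPrimitiveRoot_eps hm).pow_eq_one, mul_one]

theorem sum_gradedProj (hm : 0 < autOrder σ) :
    ∑ k ∈ Finset.range (autOrder σ), gradedProj σ (k : ℤ) = 1 := by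
  have hm0 : (autOrder σ : ℂ) ≠ 0 := by exact_mod_cast hm.ne'
  simp_rw [gradedProj, ← Finset.smul_sum]
  rw [Finset.sum_comm, Finset.sum_eq_single_of_mem 0 (Finset.mem_range.mpr hm)]
  · simp [← Nat.cast_smul_eq_nsmul ℂ, smul_smul, hm0]
  · intro l hl hl0
    rw [← Finset.sum_smul]
    simp_rw [zpow_natCast, ← pow_mul, mul_comm _ l, pow_mul]
    have hone : eps σ ^ l ≠ 1 := fun h =>
      (isPrimitiveRoot_eps hm).pow_ne_one_of_pos_of_lt hl0 (Finset.mem_range.mp hl) h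
    rw [geom_sum_eq hone, ← pow_mul, mul_comm, pow_mul, (isPrimitiveRoot_eps hm).pow_eq_one,
      one_pow, sub_self, zero_div, zero_smul]

open Classical in
theorem gradedProj_apply_of_mem (hm : 0 < autOrder σ) (k : ℤ) {n : ℤ} {x : g}
    (hx : x ∈ gradedPiece σ n) :
    gradedProj σ k x = if x ∈ gradedPiece σ (-k) then x else 0 := by
  have hm0 : (autOrder σ : ℂ) ≠ 0 := by exact_mod_cast hm.ne'
  have hval : ∀ j, x ∈ gradedPiece σ j → gradedProj σ k x =
      (autOrder σ : ℂ)⁻¹ • (∑ l ∈ Finset.range (autOrder σ), (eps σ ^ (k + j)) ^ l) • x := by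
    intro j hj
    rw [gradedProj, LinearMap.smul_apply, LinearMap.sum_apply, Finset.sum_smul]
    congr 1
    refine Finset.sum_congr rfl fun l _ => ?_
    rw [LinearMap.smul_apply, toLinearEquiv_pow_apply_of_mem hj, smul_smul, ← mul_pow,
      zpow_add₀ eps_ne_zero]
  split_ifs with hk
  · rw [hval _ hk, add_neg_cancel, zpow_zero]
    simp [smul_smul, hm0]
  · have hone : eps σ ^ (k + n) ≠ 1 := by
      intro h
      rw [zpow_add₀ eps_ne_zero] at h
      apply hk
      rw [mem_gradedPiece_iff, zpow_neg, ← eq_inv_of_mul_eq_one_right h]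
      exact mem_gradedPiece_iff.mp hx
    rw [hval _ hx, geom_sum_eq hone, ← zpow_natCast, ← zpow_mul, mul_comm, zpow_mul, zpow_natCast,
      (isPrimitiveRoot_eps hm).pow_eq_one, one_zpow, sub_self, zero_div, zero_smul, smul_zero]

theorem toLinearEquiv_pow_mul_ad {n : ℤ} {x : g} (hx : x ∈ gradedPiece σ n) (l : ℕ) :
    (σ.toLinearEquiv : Module.End ℂ g) ^ l * LieAlgebra.ad ℂ g x =
      (eps σ ^ n) ^ l • (LieAlgebra.ad ℂ g x * (σ.toLinearEquiv : Module.End ℂ g) ^ l) := by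
  have h1 : (σ.toLinearEquiv : Module.End ℂ g) * LieAlgebra.ad ℂ g x =
      eps σ ^ n • (LieAlgebra.ad ℂ g x * (σ.toLinearEquiv : Module.End ℂ g)) := by
    refine LinearMap.ext fun y => ?_
    change σ ⁅x, y⁆ = eps σ ^ n • ⁅x, σ y⁆
    rw [LieEquiv.map_lie, mem_gradedPiece_iff.mp hx, smul_lie]
  induction l with
  | zero => simp
  | succ l ih =>
    rw [pow_succ, mul_assoc, h1, mul_smul_comm, ← mul_assoc, ih, smul_mul_assoc, smul_smul,
      mul_assoc, pow_succ' (eps σ ^ n)]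

theorem gradedProj_mul_ad (k : ℤ) {n : ℤ} {x : g} (hx : x ∈ gradedPiece σ n) :
    gradedProj σ k * LieAlgebra.ad ℂ g x = LieAlgebra.ad ℂ g x * gradedProj σ (k + n) := by
  rw [gradedProj, gradedProj, smul_mul_assoc, mul_smul_comm, Finset.sum_mul, Finset.mul_sum]
  congr 1
  refine Finset.sum_congr rfl fun l _ => ?_
  rw [smul_mul_assoc, toLinearEquiv_pow_mul_ad hx, smul_smul, mul_smul_comm, ← mul_pow,
    zpow_add₀ eps_ne_zero]

theorem toLinearEquiv_mul_gradedProj (k : ℤ) :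
    (σ.toLinearEquiv : Module.End ℂ g) * gradedProj σ k =
      gradedProj σ k * (σ.toLinearEquiv : Module.End ℂ g) := by
  rw [gradedProj, smul_mul_assoc, mul_smul_comm, Finset.sum_mul, Finset.mul_sum]
  congr 1
  refine Finset.sum_congr rfl fun l _ => ?_
  rw [smul_mul_assoc, mul_smul_comm, ← pow_succ, ← pow_succ']

variable [FiniteDimensional ℂ g] [IsKilling ℂ g]

/-- The functional `z ↦ tr (ad z ∘ P)`, with `P` the projection onto an eigenspace of `σ`, is
represented for the Killing form by an element in the centre of the fixed subalgebra of `σ`. If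
this centre is trivial, then so is the functional. -/
theorem trace_ad_mul_gradedProj_eq_zero
    (hcentre : ∀ u : g, σ u = u → (∀ w, σ w = w → ⁅w, u⁆ = 0) → u = 0) (k : ℤ) (z : g) :
    LinearMap.trace ℂ g (LieAlgebra.ad ℂ g z * gradedProj σ k) = 0 := by
  set P := gradedProj σ k with hP
  let φ : Module.Dual ℂ g :=
    { toFun := fun z => LinearMap.trace ℂ g (LieAlgebra.ad ℂ g z * P)
      map_add' := fun z w => by rw [map_add, add_mul, map_add]
      map_smul' := fun t z => by rw [map_smul, smul_mul_assoc, map_smul, RingHom.id_apply] }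
  have hφ : ∀ z, φ z = LinearMap.trace ℂ g (LieAlgebra.ad ℂ g z * P) := fun _ => rfl
  have hnd : (killingForm ℂ g).Nondegenerate := IsKilling.killingForm_nondegenerate ℂ g
  let u : g := (LinearMap.BilinForm.toDual (killingForm ℂ g) hnd).symm φ
  have hu : ∀ z, killingForm ℂ g u z = φ z := fun z => by
    rw [← LinearMap.BilinForm.toDual_def hnd, LinearEquiv.apply_symm_apply]
  have hφσ : ∀ z, φ (σ z) = φ z := by
    intro z
    have h1 : LieAlgebra.ad ℂ g (σ z) * (σ.toLinearEquiv : Module.End ℂ g) =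
        (σ.toLinearEquiv : Module.End ℂ g) * LieAlgebra.ad ℂ g z :=
      LinearMap.ext fun y => (LieEquiv.map_lie σ z y).symm
    have h2 : (σ.toLinearEquiv : Module.End ℂ g) * (σ.symm.toLinearEquiv : Module.End ℂ g) = 1 :=
      LinearMap.ext fun x => σ.apply_symm_apply x
    have h3 : (σ.symm.toLinearEquiv : Module.End ℂ g) * (σ.toLinearEquiv : Module.End ℂ g) = 1 :=
      LinearMap.ext fun x => σ.symm_apply_apply x
    rw [hφ, hφ, ← mul_one (LieAlgebra.ad ℂ g (σ z)), ← h2, ← mul_assoc, h1, mul_assoc, mul_assoc,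
      LinearMap.trace_mul_comm, mul_assoc, mul_assoc, ← toLinearEquiv_mul_gradedProj,
      ← mul_assoc (σ.symm.toLinearEquiv : Module.End ℂ g), h3, one_mul]
  have hfix : σ u = u := by
    refine sub_eq_zero.mp (hnd.1 _ fun z => ?_)
    rw [map_sub, LinearMap.sub_apply, hu, ← σ.apply_symm_apply z, killingForm_of_equiv_apply, hu,
      hφσ, sub_self]
  have hcent : ∀ w, σ w = w → ⁅w, u⁆ = 0 := by
    intro w hw
    have hwP : P * LieAlgebra.ad ℂ g w = LieAlgebra.ad ℂ g w * P := by
      have h0 : w ∈ gradedPiece σ 0 := by rw [mem_gradedPiece_iff, hw, zpow_zero, one_smul]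
      rw [hP, gradedProj_mul_ad k h0, add_zero]
    rw [← lie_skew, neg_eq_zero]
    refine hnd.1 _ fun z => ?_
    have h1 : killingForm ℂ g ⁅u, w⁆ z = killingForm ℂ g u ⁅w, z⁆ :=
      LieModule.traceForm_apply_lie_apply ℂ g g u w z
    rw [h1, hu, hφ, ad_lie_eq_mul_sub_mul, sub_mul, map_sub, mul_assoc,
      LinearMap.trace_mul_comm, mul_assoc, hwP, mul_assoc, sub_self]
  have hu0 : u = 0 := hcentre u hfix hcent
  rw [← hφ, ← hu, hu0, map_zero, LinearMap.zero_apply]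

/-- The trace of `ad x ∘ ad y` on the graded pieces is periodic in the piece, with the degree of
`x` as a period: move `ad x` around the trace, at the cost of a trace of `ad ⁅x, y⁆`. -/
theorem trace_ad_mul_ad_mul_gradedProj_add
    (hcentre : ∀ u : g, σ u = u → (∀ w, σ w = w → ⁅w, u⁆ = 0) → u = 0) (k : ℤ) {p : ℤ} {x : g}
    (hx : x ∈ gradedPiece σ (-p)) (y : g) :
    LinearMap.trace ℂ g (LieAlgebra.ad ℂ g x * LieAlgebra.ad ℂ g y * gradedProj σ (k + p)) =
      LinearMap.trace ℂ g (LieAlgebra.ad ℂ g x * LieAlgebra.ad ℂ g y * gradedProj σ k) := by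
  have h0 := trace_ad_mul_gradedProj_eq_zero hcentre k ⁅x, y⁆
  rw [ad_lie_eq_mul_sub_mul, sub_mul, map_sub, sub_eq_zero] at h0
  rw [h0, LinearMap.trace_mul_comm, ← mul_assoc, gradedProj_mul_ad _ hx, add_neg_cancel_right,
    mul_assoc, LinearMap.trace_mul_comm, mul_assoc, LinearMap.trace_mul_comm, mul_assoc]

/-- Both `p` and the order `m` of `σ` are periods of the trace, so its sum over `p` consecutive
pieces is `p / m` times the sum over all `m` pieces, which is the Killing form. -/
theorem sum_trace_ad_mul_ad_mul_gradedProj (hm : 0 < autOrder σ)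
    (hcentre : ∀ u : g, σ u = u → (∀ w, σ w = w → ⁅w, u⁆ = 0) → u = 0) {p : ℕ} {x : g}
    (hx : x ∈ gradedPiece σ (-(p : ℤ))) (y : g) :
    ∑ k ∈ Finset.range p,
      LinearMap.trace ℂ g (LieAlgebra.ad ℂ g x * LieAlgebra.ad ℂ g y * gradedProj σ (k : ℤ)) =
      (p : ℂ) / (autOrder σ : ℂ) * killingForm ℂ g x y := by
  have hm0 : (autOrder σ : ℂ) ≠ 0 := by exact_mod_cast hm.ne'
  set f : ℕ → ℂ := fun k =>
    LinearMap.trace ℂ g (LieAlgebra.ad ℂ g x * LieAlgebra.ad ℂ g y * gradedProj σ (k : ℤ)) with hf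
  have hp : ∀ k, f (k + p) = f k := fun k => by
    simp only [hf, Nat.cast_add]
    exact trace_ad_mul_ad_mul_gradedProj_add hcentre k hx y
  have hmp : ∀ k, f (k + autOrder σ) = f k := fun k => by
    simp only [hf, Nat.cast_add, gradedProj_add_autOrder hm]
  have h1 := sum_range_mul_of_periodic hp (autOrder σ)
  have h2 := sum_range_mul_of_periodic hmp p
  rw [mul_comm, h2] at h1
  have hall : ∑ k ∈ Finset.range (autOrder σ), f k = killingForm ℂ g x y := by
    simp only [hf]
    rw [← map_sum, ← Finset.mul_sum, sum_gradedProj hm, mul_one]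
    rfl
  rw [hall, nsmul_eq_mul, nsmul_eq_mul] at h1
  field_simp
  linear_combination -h1

end GradedTrace

end TwistedCasimir

/-! ### The Casimir sum in the loop algebra -/

namespace TwistedCasimir

open LieAlgebra

section LoopAlgebra

variable {g : Type*} [LieRing g] [LieAlgebra ℂ g]

theorem lie_loopElt (x y : g) (a b : ℤ) :
    ⁅loopElt x a, loopElt y b⁆ = loopElt ⁅x, y⁆ (a + b) := by
  rw [loopElt, loopElt, loopElt, LieAlgebra.ExtendScalars.bracket_tmul,
    AddMonoidAlgebra.single_mul_single, mul_one]

theorem loopElt_eq_symm_single (x : g) (n : ℤ) :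
    loopElt x n = (LoopAlgebra.toFinsupp ℂ ℤ g).symm (Finsupp.single n x) :=
  (LoopAlgebra.toFinsupp_symm_single ℂ ℤ g n x).symm

theorem toFinsupp_loopElt (x : g) (n : ℤ) :
    LoopAlgebra.toFinsupp ℂ ℤ g (loopElt x n) = Finsupp.single n x :=
  LoopAlgebra.toFinsupp_single_tmul ℂ ℤ g n x

theorem loopElt_sum {J : Type*} (s : Finset J) (x : J → g) (n : ℤ) :
    loopElt (∑ j ∈ s, x j) n = ∑ j ∈ s, loopElt (x j) n := TensorProduct.tmul_sum _ _ _

theorem loopElt_smul (a : ℂ) (x : g) (n : ℤ) : loopElt (a • x) n = a • loopElt x n :=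
  TensorProduct.tmul_smul _ _ _

theorem loopElt_injective (n : ℤ) : Function.Injective (fun x : g => loopElt x n) := fun x y h => by
  have h1 := congrArg (LoopAlgebra.toFinsupp ℂ ℤ g) h
  simp only [toFinsupp_loopElt] at h1
  exact Finsupp.single_injective n h1

theorem loopAut_loopElt (σ : g ≃ₗ⁅ℂ⁆ g) (x : g) (n : ℤ) :
    loopAut σ (loopElt x n) = loopElt (eps σ ^ (-n) • σ x) n := by
  simp only [loopAut, LinearMap.comp_apply, LinearEquiv.coe_coe, toFinsupp_loopElt]
  rw [loopElt_eq_symm_single]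
  congr 1
  simp [Finsupp.lsum_apply]

theorem negProj_loopElt (x : g) (n : ℤ) :
    negProj (loopElt x n) = if n < 0 then loopElt x n else 0 := by
  simp only [negProj, LinearMap.comp_apply, LinearEquiv.coe_coe, toFinsupp_loopElt,
    Submodule.subtype_apply, Finsupp.restrictDom_apply]
  split_ifs with hn
  · rw [Finsupp.filter_single_of_pos _ (by exact hn), loopElt_eq_symm_single]
  · rw [Finsupp.filter_single_of_neg _ (by exact hn), map_zero]

theorem mem_gradedPiece_of_loopElt_mem_Lminus {σ : g ≃ₗ⁅ℂ⁆ g} {x : g} {n : ℤ}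
    (hx : loopElt x n ∈ Lminus σ) : x ∈ gradedPiece σ n := by
  have h1 : loopAut σ (loopElt x n) = loopElt x n := hx.1
  rw [loopAut_loopElt] at h1
  have h2 : eps σ ^ (-n) • σ x = x := loopElt_injective n h1
  rw [mem_gradedPiece_iff, ← h2, map_smul]
  conv_rhs => rw [smul_smul, ← zpow_add₀ eps_ne_zero, add_neg_cancel, zpow_zero, one_smul]
  rw [← map_smul, h2]

theorem casimirTerm_loopElt {J : Type*} (B B' : J → g) (k : ℕ) (j : J) (x : g) (p : ℕ) :
    casimirTerm B B' (k, j) (loopElt x (-(p : ℤ))) =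
      if k < p then loopElt ⁅B j, ⁅B' j, x⁆⁆ (-(p : ℤ)) else 0 := by
  simp only [casimirTerm, adBar, LinearMap.comp_apply, LieAlgebra.ad_apply, lie_loopElt,
    negProj_loopElt]
  by_cases hk : k < p
  · rw [if_pos (by lia), if_pos hk, lie_loopElt]
    congr 1
    ring
  · rw [if_neg (by lia), if_neg hk, lie_zero]

/-- Truncation leaves the terms with `k < p`, so that the operator acts on `x(-p)` through a sum of
partial Casimir operators of `g`. -/
theorem hasCasimirSum_loopElt {J : Type*} [Fintype J] {σ : g ≃ₗ⁅ℂ⁆ g} {B B' : J → g} {x : g}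
    {p : ℕ} {a : ℂ} [∀ k : ℕ, DecidablePred fun j => B j ∈ gradedPiece σ (-(k : ℤ))]
    (h : ∑ k ∈ Finset.range p, ∑ j with B j ∈ gradedPiece σ (-(k : ℤ)), ⁅B j, ⁅B' j, x⁆⁆ = a • x) :
    HasCasimirSum σ B B' (loopElt x (-(p : ℤ))) (a • loopElt x (-(p : ℤ))) := by
  classical
  have hk : ∀ q : ℕ × J, casimirTerm B B' q (loopElt x (-(p : ℤ))) ≠ 0 → q.1 < p := by
    rintro ⟨k, j⟩ hq
    rw [casimirTerm_loopElt] at hq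
    by_contra hkp
    exact hq (if_neg hkp)
  refine ⟨(Finset.range p ×ˢ (Finset.univ : Finset J)).finite_toSet.subset fun q hq => ?_, ?_⟩
  · simpa using hk q hq.2
  rw [finsum_mem_eq_sum_of_inter_support_eq (t := (Finset.range p ×ˢ Finset.univ).filter
    fun q => B q.2 ∈ gradedPiece σ (-(q.1 : ℤ)))]
  · rw [Finset.sum_filter, Finset.sum_product, ← loopElt_smul, ← h, loopElt_sum]
    refine Finset.sum_congr rfl fun k hkp => ?_
    rw [loopElt_sum, Finset.sum_filter]
    refine Finset.sum_congr rfl fun j _ => ?_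
    rw [casimirTerm_loopElt, if_pos (Finset.mem_range.mp hkp)]
  · ext q
    simp only [casimirIndex, Set.mem_inter_iff, Set.mem_ofPred_eq, Function.mem_support,
      Finset.coe_filter, Finset.mem_product, Finset.mem_range, Finset.mem_univ, and_true]
    exact ⟨fun ⟨h1, h2⟩ => ⟨⟨hk q h2, h1⟩, h2⟩, fun ⟨⟨_, h1⟩, h2⟩ => ⟨h1, h2⟩⟩

end LoopAlgebra

/-! ### Partial Casimir operators -/

section PartialCasimir

variable {g : Type*} [LieRing g] [LieAlgebra ℂ g]

open Classical in
/-- Against an invariant form, the partial Casimir operator of the `ε⁻ᵏ`-eigenspace of `σ` is the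
trace form of that eigenspace. -/
theorem form_partialCasimir_eq_trace {σ : g ≃ₗ⁅ℂ⁆ g} (hm : 0 < autOrder σ)
    {J : Type*} [Fintype J] [DecidableEq J] (B : Module.Basis J ℂ g)
    (hB : ∀ j, ∃ n : ℤ, B j ∈ gradedPiece σ n) {B' : J → g} {s : ℂ}
    (hdual : ∀ i j, (s • killingForm ℂ g) (B i) (B' j) = if i = j then 1 else 0)
    (k : ℤ) (x y : g) :
    (s • killingForm ℂ g) (∑ j with B j ∈ gradedPiece σ (-k), ⁅B j, ⁅B' j, x⁆⁆) y =
      LinearMap.trace ℂ g (LieAlgebra.ad ℂ g x * LieAlgebra.ad ℂ g y * gradedProj σ k) := by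
  have hcoord : ∀ v j, (s • killingForm ℂ g) v (B' j) = B.repr v j := by
    intro v j
    have h : LinearMap.flip (s • killingForm ℂ g) (B' j) = B.coord j := B.ext fun i => by
      rw [LinearMap.flip_apply, hdual, Module.Basis.coord_apply, Module.Basis.repr_self,
        Finsupp.single_apply]
    exact LinearMap.congr_fun h v
  have hinv : ∀ a b c : g, killingForm ℂ g ⁅a, b⁆ c = killingForm ℂ g a ⁅b, c⁆ := fun a b c =>
    LieModule.traceForm_apply_lie_apply ℂ g g a b c
  have hsymm : ∀ a b : g, killingForm ℂ g a b = killingForm ℂ g b a := fun a b =>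
    LieModule.traceForm_comm ℂ g g a b
  rw [LinearMap.trace_eq_matrix_trace ℂ B, Matrix.trace, map_sum, LinearMap.sum_apply,
    Finset.sum_filter]
  refine Finset.sum_congr rfl fun j _ => ?_
  obtain ⟨n, hn⟩ := hB j
  rw [Matrix.diag_apply, LinearMap.toMatrix_apply, Module.End.mul_apply,
    gradedProj_apply_of_mem hm k hn]
  split_ifs with hj
  · rw [Module.End.mul_apply, LieAlgebra.ad_apply, LieAlgebra.ad_apply, ← hcoord]
    change s • killingForm ℂ g ⁅B j, ⁅B' j, x⁆⁆ y = s • killingForm ℂ g ⁅x, ⁅y, B j⁆⁆ (B' j)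
    rw [← lie_skew (B j), map_neg, LinearMap.neg_apply, hinv, ← map_neg, lie_skew, hinv, hsymm]
  · rw [map_zero, map_zero, Finsupp.zero_apply]

open Classical in
/-- On the `ε⁻ᵖ`-eigenspace of `σ` the first `p` partial Casimir operators sum to `p / m` times the
full Casimir operator. -/
theorem sum_partialCasimir_apply [FiniteDimensional ℂ g] [IsKilling ℂ g] {σ : g ≃ₗ⁅ℂ⁆ g}
    (hm : 0 < autOrder σ)
    (hcentre : ∀ u : g, σ u = u → (∀ w, σ w = w → ⁅w, u⁆ = 0) → u = 0)
    {J : Type*} [Fintype J] [DecidableEq J] (B : Module.Basis J ℂ g)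
    (hB : ∀ j, ∃ n : ℤ, B j ∈ gradedPiece σ n) {B' : J → g} {s : ℂ} (hs : s ≠ 0)
    (hdual : ∀ i j, (s • killingForm ℂ g) (B i) (B' j) = if i = j then 1 else 0)
    {p : ℕ} {x : g} (hx : x ∈ gradedPiece σ (-(p : ℤ))) :
    ∑ k ∈ Finset.range p, ∑ j with B j ∈ gradedPiece σ (-(k : ℤ)), ⁅B j, ⁅B' j, x⁆⁆ =
      ((p : ℂ) / (autOrder σ : ℂ) * s⁻¹) • x := by
  refine sub_eq_zero.mp ((IsKilling.killingForm_nondegenerate ℂ g).1 _ fun y => ?_)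
  have h : (s • killingForm ℂ g)
      (∑ k ∈ Finset.range p, ∑ j with B j ∈ gradedPiece σ (-(k : ℤ)), ⁅B j, ⁅B' j, x⁆⁆) y =
      (p : ℂ) / (autOrder σ : ℂ) * killingForm ℂ g x y := by
    rw [← sum_trace_ad_mul_ad_mul_gradedProj hm hcentre hx y, map_sum, LinearMap.sum_apply]
    exact Finset.sum_congr rfl fun k _ => form_partialCasimir_eq_trace hm B hB hdual k x y
  rw [LinearMap.smul_apply, LinearMap.smul_apply, smul_eq_mul] at h
  rw [map_sub, LinearMap.sub_apply, map_smul, LinearMap.smul_apply, smul_eq_mul, sub_eq_zero]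
  field_simp
  linear_combination h

end PartialCasimir

end TwistedCasimir

/-! ### The eigenvalue of the Casimir sum -/

theorem mainTheorem4 {g : Type*} [LieRing g] [LieAlgebra ℂ g] [FiniteDimensional ℂ g]
    [LieAlgebra.IsSimple ℂ g] {ι : Type*} [Fintype ι] {H : LieSubalgebra ℂ g}
    (c : LieAlgebra.Basis ι H) (σ : g ≃ₗ⁅ℂ⁆ g) (hσ : TwistedCasimir.IsSpecial c σ)
    {J : Type*} [Fintype J] [DecidableEq J] (B : Module.Basis J ℂ g)
    (hB : ∀ j, ∃ n : ℤ, B j ∈ TwistedCasimir.gradedPiece σ n)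
    (x : g) (p : ℕ) (hp : 0 < p)
    (hx : TwistedCasimir.loopElt x (-(p : ℤ)) ∈ TwistedCasimir.Lminus σ) :
    (∀ B' : J → g,
      (∀ i j, TwistedCasimir.normalizedForm c (B i) (B' j) = if i = j then 1 else 0) →
      TwistedCasimir.HasCasimirSum σ B B' (TwistedCasimir.loopElt x (-(p : ℤ)))
        ((2 * (p : ℂ) * (TwistedCasimir.dualCoxeterNumber c : ℂ) /
          (TwistedCasimir.autOrder σ : ℂ)) • TwistedCasimir.loopElt x (-(p : ℤ)))) ∧
    (∀ κ : g →ₛₗ[starRingEnd ℂ] g, TwistedCasimir.IsCompactInvolution c κ →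
      (∀ i j, TwistedCasimir.hermForm c κ (B i) (B j) = if i = j then 1 else 0) →
      TwistedCasimir.HasCasimirSum σ B (fun j => -κ (B j))
        (TwistedCasimir.loopElt x (-(p : ℤ)))
        ((2 * (p : ℂ) * (TwistedCasimir.dualCoxeterNumber c : ℂ) /
          (TwistedCasimir.autOrder σ : ℂ)) • TwistedCasimir.loopElt x (-(p : ℤ)))) := by
  classical
  have hL := TwistedCasimir.killingLengthSq_mul_dualCoxeterNumber c
  have hL0 : TwistedCasimir.killingLengthSq c ≠ 0 := left_ne_zero_of_mul_eq_one hL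
  have hdual : ∀ B' : J → g,
      (∀ i j, TwistedCasimir.normalizedForm c (B i) (B' j) = if i = j then 1 else 0) →
      TwistedCasimir.HasCasimirSum σ B B' (TwistedCasimir.loopElt x (-(p : ℤ)))
        ((2 * (p : ℂ) * (TwistedCasimir.dualCoxeterNumber c : ℂ) /
          (TwistedCasimir.autOrder σ : ℂ)) • TwistedCasimir.loopElt x (-(p : ℤ))) := by
    intro B' hB'
    refine TwistedCasimir.hasCasimirSum_loopElt ?_
    have h := TwistedCasimir.sum_partialCasimir_apply hσ.autOrder_pos
      (fun u => hσ.eq_zero_of_central_fixed) B hB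
      (div_ne_zero hL0 two_ne_zero) hB' (TwistedCasimir.mem_gradedPiece_of_loopElt_mem_Lminus hx)
    have hh : (TwistedCasimir.killingLengthSq c / 2)⁻¹ =
        2 * (TwistedCasimir.dualCoxeterNumber c : ℂ) := by
      rw [inv_div, eq_comm, eq_div_iff hL0]
      linear_combination 2 * hL
    rw [hh] at h
    convert h using 2
    ring
  -- For the compact involution, `-κ (B j)` is the dual basis by definition of the Hermitian form.
  refine ⟨hdual, fun κ _ hκ => hdual _ fun i j => ?_⟩
  rw [map_neg, ← hκ i j, TwistedCasimir.hermForm]
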